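/- Let $d\ge 1$ be an integer. A vector $\boldsymbol{\alpha}=(\alpha_1,\dots,\alpha_m)$ is a contraction vector (for $\mathbb{R}^d$) if $0<\alpha_i<1$ for all $i$ and $\sum_{i=1}^m\alpha_i^d<1$. Let $\mathcal{D}(\boldsymbol{\alpha})$ denote the collection of all dust-like self-similar sets in $\mathbb{R}^d$ with ratios $\boldsymbol{\alpha}$, i.e. of all nonempty compact $E\subset\mathbb{R}^d$ for which there are maps $f_i(x)=\alpha_iR_i(x+t_i)$, with $R_i$ an orthogonal matrix and $t_i\in\mathbb{R}^d$ ($1\le i\le m$), such that $E=\bigcup_{i=1}^m f_i(E)$ and $f_i(E)\cap f_j(E)=\emptyset$ for $i\ne j$. Two nonempty compact sets $E,F\subset\mathbb{R}^d$ are Lipschitz equivalent, $E\sim F$, if there are a bijection $\phi:E\to F$ and a constant $C>0$ with $C^{-1}|x-y|\le|\phi(x)-\phi(y)|\le C|x-y|$ for all $x,y\in E$. Write $\mathcal{D}(\boldsymbol{\alpha})\sim\mathcal{D}(\boldsymbol{\beta})$ if $E\sim F$ for some $E\in\mathcal{D}(\boldsymbol{\alpha})$ and $F\in\mathcal{D}(\boldsymbol{\beta})$.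 **Corollary.** Let $m,n\ge 2$ be integers, let $\boldsymbol{\alpha}=(\alpha,\dots,\alpha)\in\mathbb{R}^m$ and $\boldsymbol{\beta}=(\beta,\dots,\beta)\in\mathbb{R}^n$ be homogeneous contraction vectors for $\mathbb{R}^d$, and suppose that $m\alpha^s=n\beta^s=1$ for some real number $s$. Then $\mathcal{D}(\boldsymbol{\alpha})\sim\mathcal{D}(\boldsymbol{\beta})$ if and only if $\dfrac{\log m}{\log n}\in\mathbb{Q}$. -/

import Mathlib

namespace CantorLip

/-- A contraction vector for `ℝ^d`: all ratios lie in `(0,1)` and `∑ αᵢ ^ d < 1`. -/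
def IsContractionVector (d : ℕ) {m : ℕ} (α : Fin m → ℝ) : Prop :=
  (∀ i, 0 < α i ∧ α i < 1) ∧ ∑ i, α i ^ d < 1

/-- The contracting similarity `x ↦ r R (x + t)` of `ℝ^d`, where `R` is an orthogonal
transformation. -/
noncomputable def similarity {d : ℕ} (r : ℝ)
    (R : EuclideanSpace ℝ (Fin d) ≃ₗᵢ[ℝ] EuclideanSpace ℝ (Fin d))
    (t : EuclideanSpace ℝ (Fin d)) (x : EuclideanSpace ℝ (Fin d)) :
    EuclideanSpace ℝ (Fin d) :=
  r • R (x + t)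

/-- `𝒟(α)`: the collection of all dust-like self-similar sets in `ℝ^d` with ratios `α`, that is,
the nonempty compact `E` with `E = ⋃ᵢ fᵢ(E)` and `fᵢ(E) ∩ fⱼ(E) = ∅` for `i ≠ j`, for some
similarities `fᵢ(x) = αᵢ Rᵢ (x + tᵢ)`. -/
def dustLike (d : ℕ) {m : ℕ} (α : Fin m → ℝ) : Set (Set (EuclideanSpace ℝ (Fin d))) :=
  {E | E.Nonempty ∧ IsCompact E ∧
    ∃ (R : Fin m → (EuclideanSpace ℝ (Fin d) ≃ₗᵢ[ℝ] EuclideanSpace ℝ (Fin d)))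
      (t : Fin m → EuclideanSpace ℝ (Fin d)),
      E = ⋃ i, similarity (α i) (R i) (t i) '' E ∧
      ∀ i j, i ≠ j →
        Disjoint (similarity (α i) (R i) (t i) '' E) (similarity (α j) (R j) (t j) '' E)}

/-- `E ∼ F`: there is a bi-Lipschitz bijection from `E` onto `F`. -/
def LipschitzEquivalent {d : ℕ} (E F : Set (EuclideanSpace ℝ (Fin d))) : Prop :=
  ∃ (φ : E ≃ F) (C : ℝ), 0 < C ∧
    ∀ x y : E, C⁻¹ * dist x y ≤ dist (φ x) (φ y) ∧ dist (φ x) (φ y) ≤ C * dist x y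

/-- `𝒟(α) ∼ 𝒟(β)`: `E ∼ F` for some `E ∈ 𝒟(α)` and `F ∈ 𝒟(β)`. -/
def DustLikeEquivalent (d : ℕ) {m n : ℕ} (α : Fin m → ℝ) (β : Fin n → ℝ) : Prop :=
  ∃ E ∈ dustLike d α, ∃ F ∈ dustLike d β, LipschitzEquivalent E F

end CantorLip

/-! Necessity compares cylinder counts. Transport the coding of `F` to `E` by the bi-Lipschitz map,
and choose `a k` with `β ^ a k` comparable to `α ^ k`. Each `m`-letter cylinder of depth `k` is then
a union of boundedly many `n`-letter cylinders of depth `a k`; let `J k` be the largest such number.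
Subdividing a maximal cylinder and averaging over its `m` children shows that `J k * m ^ k / n ^ a
k` is nondecreasing. It is bounded because `m α^s = n β^s = 1`. Since `J` takes finitely many
values, it repeats, and unless some `m ^ r = n ^ t` with `r ≥ 1`, each repetition forces growth by a
fixed factor (`exists_pow_eq_pow_of_bounded`), a contradiction.

Sufficiency: if `m ^ u = n ^ v` with `u`, `v` coprime, then `m = k ^ v`, `n = k ^ u`, and `α = γ ^
v`, `β = γ ^ u` for one `γ`. A single dust-like set with `k` pieces of ratio `γ`
(`dustLike_nonempty`) lies in both classes by iteration (`mem_dustLike_pow`). -/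

namespace CantorLip

/-! ### Counting cylinders of one coding inside those of another -/

/-- The set of words of length `l` that begin the codes of points of `S`. -/
def prefixes {X : Type*} {n : ℕ} (q : X → ℕ → Fin n) (l : ℕ) (S : Set X) : Set (Fin l → Fin n) :=
  (fun x (i : Fin l) => q x i) '' S

/-- The points whose code agrees with that of `z` in the first `k` letters. -/
def cylinder {X : Type*} {m : ℕ} (p : X → ℕ → Fin m) (k : ℕ) (z : X) : Set X :=
  {x | ∀ i < k, p x i = p z i}

/-- As `S` is a union of `q`-cylinders of depth `l` and every finite word occurs, each prefix
extends by all `n` letters. -/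
lemma mul_ncard_prefixes_le {X : Type*} {n : ℕ} (q : X → ℕ → Fin n) (l : ℕ) (S : Set X)
    (hq : ∀ (w : ℕ → Fin n) k, ∃ x, ∀ i < k, q x i = w i)
    (hS : ∀ x ∈ S, cylinder q l x ⊆ S) :
    n * (prefixes q l S).ncard ≤ (prefixes q (l + 1) S).ncard := by
  have h := Set.ncard_le_ncard_of_injOn (s := (Set.univ : Set (Fin n)) ×ˢ prefixes q l S)
    (t := prefixes q (l + 1) S) (fun a => Fin.snoc (α := fun _ => Fin n) a.2 a.1)
    (by
      rintro ⟨i, w⟩ ⟨-, x, hx, rfl⟩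
      obtain ⟨y, hy⟩ := hq (fun j => if j < l then q x j else i) (l + 1)
      refine ⟨y, hS x hx fun j hj => ?_, ?_⟩
      · rw [hy j (by omega), if_pos hj]
      · funext j
        refine Fin.lastCases ?_ (fun j => ?_) j
        · simp [hy l (by omega)]
        · simp [hy j (by omega)])
    (by
      rintro ⟨i, w⟩ - ⟨i', w'⟩ - h
      have := Fin.snoc_injective2 (α := fun _ => Fin n) h
      exact Prod.ext this.2 this.1) (Set.toFinite _)
  rwa [Set.ncard_prod, Set.ncard_univ, Nat.card_fin] at h

lemma pow_mul_ncard_prefixes_le {X : Type*} {n : ℕ} (q : X → ℕ → Fin n) (l r : ℕ) (S : Set X)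
    (hq : ∀ (w : ℕ → Fin n) k, ∃ x, ∀ i < k, q x i = w i)
    (hS : ∀ x ∈ S, cylinder q l x ⊆ S) :
    n ^ r * (prefixes q l S).ncard ≤ (prefixes q (l + r) S).ncard := by
  induction r with
  | zero => simp
  | succ r ih =>
    calc n ^ (r + 1) * (prefixes q l S).ncard = n * (n ^ r * (prefixes q l S).ncard) := by ring
      _ ≤ n * (prefixes q (l + r) S).ncard := Nat.mul_le_mul_left _ ih
      _ ≤ _ := mul_ncard_prefixes_le q (l + r) S hq
        fun x hx y hy => hS x hx fun i hi => hy i (by omega)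

lemma ncard_prefixes_le {X : Type*} {n : ℕ} (q : X → ℕ → Fin n) (l j : ℕ) (z : X) (S : Set X)
    (hS : S ⊆ cylinder q j z) : (prefixes q l S).ncard ≤ n ^ (l - j) := by
  have h := Set.ncard_le_ncard_of_injOn (s := prefixes q l S)
    (t := (Set.univ : Set (Fin (l - j) → Fin n))) (fun w i => w ⟨j + i, by omega⟩)
    (fun _ _ => Set.mem_univ _)
    (by
      rintro _ ⟨x, hx, rfl⟩ _ ⟨y, hy, rfl⟩ h
      funext i
      rcases lt_or_ge (i : ℕ) j with hi | hi
      · exact (hS hx i hi).trans (hS hy i hi).symm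
      · have := congrFun h ⟨i - j, by omega⟩
        simpa [Nat.add_sub_cancel' hi] using this) (Set.toFinite _)
  simpa [Set.ncard_univ] using h

/-- Averaging over the next letter: the children cover the cylinder, so one carries at least the
mean. Some children may be empty, as `p` need not realize every word. -/
lemma exists_ncard_prefixes_cylinder_succ {X : Type*} {m n : ℕ} (p : X → ℕ → Fin m)
    (q : X → ℕ → Fin n) (l k : ℕ) (z : X) :
    ∃ z', (prefixes q l (cylinder p k z)).ncard ≤
      m * (prefixes q l (cylinder p (k + 1) z')).ncard := by
  by_contra! hcon
  set T : Fin m → Set X := fun i => {x ∈ cylinder p k z | p x k = i} with hT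
  have hcov : prefixes q l (cylinder p k z) ⊆
      ⋃ i ∈ (Finset.univ : Finset (Fin m)), prefixes q l (T i) := by
    rintro _ ⟨x, hx, rfl⟩
    simp only [Finset.mem_univ, Set.iUnion_true, Set.mem_iUnion]
    exact ⟨p x k, x, ⟨hx, rfl⟩, rfl⟩
  have hle : (prefixes q l (cylinder p k z)).ncard ≤ ∑ i, (prefixes q l (T i)).ncard :=
    (Set.ncard_le_ncard hcov (Set.toFinite _)).trans
      (Finset.set_ncard_biUnion_le _ _)
  have hpos : 0 < (prefixes q l (cylinder p k z)).ncard := (Nat.zero_le _).trans_lt (hcon z)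
  have hm : 0 < m := (p z 0).pos
  have hT' : ∀ i, m * (prefixes q l (T i)).ncard < (prefixes q l (cylinder p k z)).ncard := by
    intro i
    rcases (T i).eq_empty_or_nonempty with h | ⟨x, hx⟩
    · simpa [h, prefixes] using hpos
    · refine lt_of_le_of_lt (Nat.mul_le_mul_left _
        (Set.ncard_le_ncard (Set.image_mono ?_) (Set.toFinite _))) (hcon x)
      intro y hy j hj
      rcases Nat.lt_succ_iff_lt_or_eq.mp hj with hj | rfl
      · exact (hy.1 j hj).trans (hx.1 j hj).symm
      · exact hy.2.trans hx.2.symm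
  have : ∑ i : Fin m, m * (prefixes q l (T i)).ncard <
      ∑ _i : Fin m, (prefixes q l (cylinder p k z)).ncard :=
    Finset.sum_lt_sum_of_nonempty ⟨⟨0, hm⟩, Finset.mem_univ _⟩ fun i _ => hT' i
  rw [← Finset.mul_sum, Finset.sum_const, Finset.card_univ, Fintype.card_fin, smul_eq_mul] at this
  exact absurd (Nat.mul_le_mul_left m hle) (not_le.mpr this)

/-- A bounded sequence of positive integers which, after rescaling by `m ^ k / n ^ a k`, is
nondecreasing and bounded forces a multiplicative relation between `m` and `n`. -/
lemma exists_pow_eq_pow_of_bounded {m n M : ℕ} (hm : 2 ≤ m) (hn : 2 ≤ n) (a J : ℕ → ℕ) (B : ℝ)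
    (ha : Monotone a) (hJ : ∀ k, 1 ≤ J k ∧ J k ≤ M)
    (hstep : ∀ k, n ^ (a (k + 1) - a k) * J k ≤ m * J (k + 1))
    (hB : ∀ k, (m : ℝ) ^ k ≤ B * (n : ℝ) ^ a k) :
    ∃ r t : ℕ, 1 ≤ r ∧ m ^ r = n ^ t := by
  by_contra! hcon
  have hm0 : (0 : ℝ) < m := by positivity
  have hn0 : (0 : ℝ) < n := by positivity
  set ρ : ℕ → ℝ := fun k => J k * (m : ℝ) ^ k / (n : ℝ) ^ a k with hρ
  have hmono : Monotone ρ := by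
    refine monotone_nat_of_le_succ fun k => ?_
    have h : (n : ℝ) ^ (a (k + 1) - a k) * J k ≤ m * J (k + 1) := by exact_mod_cast hstep k
    have hpow : (n : ℝ) ^ a (k + 1) = (n : ℝ) ^ (a (k + 1) - a k) * (n : ℝ) ^ a k := by
      rw [← pow_add, Nat.sub_add_cancel (ha k.le_succ)]
    simp only [hρ]
    rw [div_le_div_iff₀ (by positivity) (by positivity), hpow, pow_succ]
    calc (J k : ℝ) * m ^ k * (n ^ (a (k + 1) - a k) * n ^ a k)
        = (n ^ (a (k + 1) - a k) * J k) * (m ^ k * n ^ a k) := by ring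
      _ ≤ (m * J (k + 1)) * (m ^ k * n ^ a k) := by gcongr
      _ = _ := by ring
  have hpos : ∀ k, 0 < ρ k := fun k => by
    have : (0 : ℝ) < J k := by exact_mod_cast (hJ k).1
    positivity
  -- Among `M + 1` consecutive indices `J` repeats. There the ratio of the `ρ` values is a quotient
  -- of distinct integers with denominator at most `m ^ M`, hence at least `1 + η`.
  set η : ℝ := ((m : ℝ) ^ M)⁻¹ with hη
  have hη0 : 0 < η := by positivity
  have hblock : ∀ k, (1 + η) * ρ k ≤ ρ (k + M) := by
    intro k
    obtain ⟨x, hx, y, hy, hxy, hval⟩ := Finset.exists_ne_map_eq_of_card_lt_of_maps_to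
      (s := Finset.Icc k (k + M)) (t := Finset.Icc 1 M) (f := J)
      (by simp; omega) (fun i _ => by simpa using hJ i)
    wlog hlt : x < y generalizing x y
    · exact this y hy x hx hxy.symm hval.symm (by omega)
    rw [Finset.mem_Icc] at hx hy
    have hJx : (0 : ℝ) < J x := by exact_mod_cast (hJ x).1
    have hratio : ρ y = ρ x * ((m : ℝ) ^ (y - x) / (n : ℝ) ^ (a y - a x)) := by
      have h1 : (m : ℝ) ^ y = (m : ℝ) ^ x * (m : ℝ) ^ (y - x) := by
        rw [← pow_add, Nat.add_sub_cancel' hlt.le]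
      have h2 : (n : ℝ) ^ a y = (n : ℝ) ^ a x * (n : ℝ) ^ (a y - a x) := by
        rw [← pow_add, Nat.add_sub_cancel' (ha hlt.le)]
      simp only [hρ]
      rw [h1, h2, ← hval]
      field_simp
    have hge : (n : ℝ) ^ (a y - a x) ≤ (m : ℝ) ^ (y - x) := by
      have h : ρ x * 1 ≤ ρ x * ((m : ℝ) ^ (y - x) / (n : ℝ) ^ (a y - a x)) := by
        rw [← hratio, mul_one]; exact hmono hlt.le
      exact (one_le_div (by positivity)).mp (le_of_mul_le_mul_left h (hpos x))
    have hlt' : n ^ (a y - a x) + 1 ≤ m ^ (y - x) := by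
      have h : n ^ (a y - a x) ≤ m ^ (y - x) := by exact_mod_cast hge
      exact lt_of_le_of_ne h (hcon (y - x) (a y - a x) (by omega)).symm
    have hlt'' : (n : ℝ) ^ (a y - a x) + 1 ≤ (m : ℝ) ^ (y - x) := by exact_mod_cast hlt'
    have hle : (n : ℝ) ^ (a y - a x) ≤ (m : ℝ) ^ M :=
      hge.trans (pow_le_pow_right₀ (by exact_mod_cast (by omega : 1 ≤ m)) (by omega))
    have hfac : 1 + η ≤ (m : ℝ) ^ (y - x) / (n : ℝ) ^ (a y - a x) := by
      rw [le_div_iff₀ (by positivity), add_mul, one_mul]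
      refine le_trans ?_ hlt''
      gcongr
      rw [hη, inv_mul_le_iff₀ (by positivity), mul_one]
      exact hle
    calc (1 + η) * ρ k ≤ (1 + η) * ρ x := by gcongr; exact hmono hx.1
      _ ≤ (m : ℝ) ^ (y - x) / (n : ℝ) ^ (a y - a x) * ρ x :=
        mul_le_mul_of_nonneg_right hfac (hpos x).le
      _ = ρ y := by rw [hratio, mul_comm]
      _ ≤ ρ (k + M) := hmono hy.2
  have hgrow : ∀ i, (1 + η) ^ i * ρ 0 ≤ ρ (M * i) := by
    intro i
    induction i with
    | zero => simp
    | succ i ih =>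
      calc (1 + η) ^ (i + 1) * ρ 0 = (1 + η) * ((1 + η) ^ i * ρ 0) := by ring
        _ ≤ (1 + η) * ρ (M * i) := by gcongr
        _ ≤ ρ (M * i + M) := hblock _
        _ = _ := by rw [Nat.mul_succ]
  have hbdd : ∀ k, ρ k ≤ M * B := by
    intro k
    simp only [hρ]
    rw [div_le_iff₀ (by positivity), mul_assoc]
    have : (J k : ℝ) ≤ M := by exact_mod_cast (hJ k).2
    exact mul_le_mul this (hB k) (by positivity) (by positivity)
  obtain ⟨i, hi⟩ := pow_unbounded_of_one_lt (M * B / ρ 0) (lt_add_of_pos_right 1 hη0)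
  rw [div_lt_iff₀ (hpos 0)] at hi
  exact absurd ((hgrow i).trans (hbdd _)) (not_le.mpr hi)

/-- Two codings of the same set by words in `m` and in `n` letters whose cylinders are uniformly
comparable exist only for multiplicatively dependent `m` and `n`. -/
lemma exists_pow_eq_pow_of_codings {X : Type*} [Nonempty X] {m n c : ℕ} (hm : 2 ≤ m) (hn : 2 ≤ n)
    (p : X → ℕ → Fin m) (q : X → ℕ → Fin n)
    (hq : ∀ (w : ℕ → Fin n) k, ∃ x, ∀ i < k, q x i = w i)
    (a : ℕ → ℕ) (B : ℝ) (ha : Monotone a)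
    (hqp : ∀ k z, cylinder q (a k) z ⊆ cylinder p k z)
    (hpq : ∀ k z, cylinder p k z ⊆ cylinder q (a k - c) z)
    (hB : ∀ k, (m : ℝ) ^ k ≤ B * (n : ℝ) ^ a k) :
    ∃ r t : ℕ, 1 ≤ r ∧ m ^ r = n ^ t := by
  have hbd : ∀ k z, (prefixes q (a k) (cylinder p k z)).ncard ≤ n ^ c := fun k z =>
    (ncard_prefixes_le q _ _ z _ (hpq k z)).trans (Nat.pow_le_pow_right (by omega) (by omega))
  have hbdd : ∀ k, BddAbove (Set.range fun z => (prefixes q (a k) (cylinder p k z)).ncard) :=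
    fun k => ⟨n ^ c, by rintro _ ⟨z, rfl⟩; exact hbd k z⟩
  refine exists_pow_eq_pow_of_bounded (M := n ^ c) hm hn a
    (fun k => ⨆ z, (prefixes q (a k) (cylinder p k z)).ncard) B ha (fun k => ⟨?_, ?_⟩)
    (fun k => ?_) hB
  · obtain ⟨z⟩ := ‹Nonempty X›
    refine le_trans ?_ (le_ciSup (hbdd k) z)
    exact (Set.ncard_pos (Set.toFinite _)).mpr ⟨_, z, fun _ _ => rfl, rfl⟩
  · exact ciSup_le (hbd k)
  -- A bounded set of naturals attains its supremum, so a maximal cylinder exists.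
  · obtain ⟨z, hz⟩ := Nat.sSup_mem (Set.range_nonempty
      fun z => (prefixes q (a k) (cylinder p k z)).ncard) (hbdd k)
    obtain ⟨z', hz'⟩ := exists_ncard_prefixes_cylinder_succ p q (a (k + 1)) k z
    have hsat : ∀ x ∈ cylinder p k z, cylinder q (a k) x ⊆ cylinder p k z :=
      fun x hx y hy i hi => (hqp k x hy i hi).trans (hx i hi)
    have h := pow_mul_ncard_prefixes_le q (a k) (a (k + 1) - a k) _ hq hsat
    rw [Nat.add_sub_cancel' (ha k.le_succ)] at h
    calc n ^ (a (k + 1) - a k) * (⨆ z, (prefixes q (a k) (cylinder p k z)).ncard)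
        = n ^ (a (k + 1) - a k) * (prefixes q (a k) (cylinder p k z)).ncard :=
          congrArg _ hz.symm
      _ ≤ _ := h
      _ ≤ _ := hz'
      _ ≤ _ := Nat.mul_le_mul_left _ (le_ciSup (hbdd (k + 1)) z')

/-! ### Codings of dust-like sets and their metric comparison -/

lemma dist_similarity {d : ℕ} {r : ℝ} (hr : 0 ≤ r)
    (R : EuclideanSpace ℝ (Fin d) ≃ₗᵢ[ℝ] EuclideanSpace ℝ (Fin d))
    (t x y : EuclideanSpace ℝ (Fin d)) :
    dist (similarity r R t x) (similarity r R t y) = r * dist x y := by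
  simp [similarity, dist_smul₀, abs_of_nonneg hr]

lemma exists_le_dist_of_disjoint {X : Type*} [MetricSpace X] {ι : Type*} [Finite ι]
    (K : ι → Set X) (hK : ∀ i, IsCompact (K i)) (hd : ∀ i j, i ≠ j → Disjoint (K i) (K j)) :
    ∃ δ : ℝ, 0 < δ ∧ ∀ i j, i ≠ j → ∀ x ∈ K i, ∀ y ∈ K j, δ ≤ dist x y := by
  have h : ∀ a : ι × ι, ∃ δ : ℝ, 0 < δ ∧ (a.1 ≠ a.2 → ∀ x ∈ K a.1, ∀ y ∈ K a.2, δ ≤ dist x y) := by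
    rintro ⟨i, j⟩
    by_cases hij : i = j
    · exact ⟨1, one_pos, fun h => absurd hij h⟩
    · obtain ⟨r, hr, h⟩ := Metric.exists_pos_forall_lt_edist (hK i) (hK j).isClosed (hd i j hij)
      refine ⟨r, hr, fun _ x hx y hy => ?_⟩
      have := h x hx y hy
      rw [edist_nndist, ENNReal.coe_lt_coe] at this
      exact_mod_cast this.le
  choose δ hδ h using h
  cases nonempty_fintype ι
  rcases isEmpty_or_nonempty ι with he | he
  · exact ⟨1, one_pos, fun i => he.elim i⟩
  · refine ⟨Finset.univ.inf' Finset.univ_nonempty δ, (Finset.lt_inf'_iff _).mpr fun a _ => hδ a,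
      fun i j hij x hx y hy => (Finset.inf'_le _ (Finset.mem_univ (i, j))).trans
        (h (i, j) hij x hx y hy)⟩

/-- Points of a dust-like set with equal ratios are coded by infinite words, the distance of two
points being comparable with the ratio to the power of the length of the common prefix. -/
lemma exists_coding_of_mem_dustLike {d m : ℕ} {α : ℝ} (hα0 : 0 < α) (hα1 : α < 1)
    {E : Set (EuclideanSpace ℝ (Fin d))} (hE : E ∈ dustLike d (fun _ : Fin m => α)) :
    ∃ (p : E → ℕ → Fin m) (D δ : ℝ), 0 < D ∧ 0 < δ ∧
      (∀ (w : ℕ → Fin m) k, ∃ x, ∀ i < k, p x i = w i) ∧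
      (∀ k x y, x ∈ cylinder p k y → dist x y ≤ D * α ^ k) ∧
      (∀ k x y, dist x y < δ * α ^ k → x ∈ cylinder p k y) := by
  obtain ⟨hne, hcpt, R, t, hU, hdisj⟩ := hE
  set f : Fin m → EuclideanSpace ℝ (Fin d) → EuclideanSpace ℝ (Fin d) :=
    fun i => similarity α (R i) (t i) with hf
  have hdist : ∀ i x y, dist (f i x) (f i y) = α * dist x y :=
    fun i x y => dist_similarity hα0.le _ _ _ _
  have hmaps : ∀ i, ∀ x ∈ E, f i x ∈ E := fun i x hx => by
    exact hU.superset (Set.mem_iUnion.mpr ⟨i, x, hx, rfl⟩)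
  have hcont : ∀ i, Continuous (f i) := fun i => by
    simp only [hf]; unfold similarity; fun_prop
  obtain ⟨δ, hδ, hgap⟩ := exists_le_dist_of_disjoint (fun i => f i '' E)
    (fun i => hcpt.image (hcont i)) hdisj
  have hdec : ∀ x : E, ∃ (i : Fin m) (y : E), f i y = x := fun x => by
    obtain ⟨i, y, hy, h⟩ := Set.mem_iUnion.mp (hU.subset x.2)
    exact ⟨i, ⟨y, hy⟩, h⟩
  -- `g` reads the first letter and `T` is the shift; disjointness of the pieces makes both unique.
  choose g T hgT using hdec
  have huniq : ∀ i (y x : E), f i y = x → g x = i ∧ T x = y := by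
    intro i y x h
    have hi : g x = i := by
      by_contra hne
      have hd := hdisj _ _ hne
      exact Set.disjoint_left.mp hd ⟨T x, (T x).2, hgT x⟩ ⟨y, y.2, h⟩
    refine ⟨hi, ?_⟩
    have h' := hdist i (T x) y
    rw [h, ← hi, hgT x, dist_self] at h'
    have : dist (T x : EuclideanSpace ℝ (Fin d)) y = 0 := by
      rcases mul_eq_zero.mp h'.symm with h | h
      · exact absurd h hα0.ne'
      · exact h
    exact Subtype.ext (dist_eq_zero.mp this)
  have hstep : ∀ x y : E, g x = g y → dist x y = α * dist (T x) (T y) := fun x y h => by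
    rw [Subtype.dist_eq, ← hgT x, ← hgT y, h, hdist]; rfl
  obtain ⟨D, hD⟩ := Metric.isBounded_iff.mp hcpt.isBounded
  set p : E → ℕ → Fin m := fun x k => g (T^[k] x) with hp
  have hpow : ∀ k (x y : E), x ∈ cylinder p k y → dist x y = α ^ k * dist (T^[k] x) (T^[k] y) := by
    intro k
    induction k with
    | zero => intro x y _; simp
    | succ k ih =>
      intro x y h
      rw [ih x y fun i hi => h i (by omega), hstep _ _ (h k (by omega)),
        Function.iterate_succ_apply', Function.iterate_succ_apply', pow_succ]
      ring
  refine ⟨p, max D 1, δ, by positivity, hδ, ?_, ?_, ?_⟩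
  · intro w k
    induction k generalizing w with
    | zero => exact ⟨⟨_, hne.some_mem⟩, fun i hi => absurd hi (by omega)⟩
    | succ k ih =>
      obtain ⟨x, hx⟩ := ih (fun i => w (i + 1))
      obtain ⟨h1, h2⟩ := huniq (w 0) x ⟨f (w 0) x, hmaps _ _ x.2⟩ rfl
      refine ⟨⟨f (w 0) x, hmaps _ _ x.2⟩, fun i hi => ?_⟩
      cases i with
      | zero => exact h1
      | succ i =>
        simp only [hp, Function.iterate_succ_apply, h2]
        exact hx i (by omega)
  · intro k x y h
    rw [hpow k x y h, mul_comm]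
    gcongr
    exact (hD (T^[k] x).2 (T^[k] y).2).trans (le_max_left _ _)
  · intro k x y h
    induction k with
    | zero => exact fun i hi => absurd hi (by omega)
    | succ k ih =>
      have hk : x ∈ cylinder p k y := ih (h.trans_le (by
        gcongr δ * ?_
        exact pow_le_pow_of_le_one hα0.le hα1.le k.le_succ))
      intro i hi
      rcases Nat.lt_succ_iff_lt_or_eq.mp hi with hi | rfl
      · exact hk i hi
      · by_contra hne
        have h1 := hgap _ _ hne _ ⟨T (T^[i] x), (T (T^[i] x)).2, hgT _⟩ _
          ⟨T (T^[i] y), (T (T^[i] y)).2, hgT _⟩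
        have h2 := hpow i x y hk
        have h3 : δ * α ^ i ≤ dist x y := by
          rw [h2, mul_comm]; gcongr; exact h1
        have h4 : δ * α ^ (i + 1) ≤ δ * α ^ i := by
          gcongr δ * ?_
          exact pow_le_pow_of_le_one hα0.le hα1.le i.le_succ
        linarith

/-- Lipschitz equivalent dust-like sets with equal ratios and the same dimension have
multiplicatively dependent numbers of pieces. -/
lemma exists_pow_eq_pow_of_dustLikeEquivalent {d m n : ℕ} (hm : 2 ≤ m) (hn : 2 ≤ n) {α β s : ℝ}
    (hα0 : 0 < α) (hα1 : α < 1) (hβ0 : 0 < β) (hβ1 : β < 1)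
    (hαs : (m : ℝ) * α ^ s = 1) (hβs : (n : ℝ) * β ^ s = 1)
    (h : DustLikeEquivalent d (fun _ : Fin m => α) (fun _ : Fin n => β)) :
    ∃ r t : ℕ, 1 ≤ r ∧ m ^ r = n ^ t := by
  obtain ⟨E, hE, F, hF, φ, C, hC, hφ⟩ := h
  have : Nonempty E := hE.1.to_subtype
  obtain ⟨p, D₁, δ₁, hD₁, hδ₁, -, hp1, hp2⟩ := exists_coding_of_mem_dustLike hα0 hα1 hE
  obtain ⟨q, D₂, δ₂, hD₂, hδ₂, hq0, hq1, hq2⟩ := exists_coding_of_mem_dustLike hβ0 hβ1 hF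
  have hs : 0 < s := by
    by_contra! hs
    have h1 : (1 : ℝ) ≤ α ^ s := Real.one_le_rpow_of_pos_of_le_one_of_nonpos hα0 hα1.le hs
    have h2 : (2 : ℝ) ≤ m := by exact_mod_cast hm
    nlinarith
  -- The first bound puts `q`-cylinders of depth `l k + 1` inside `p`-cylinders of depth `k`; the
  -- bound by `1` ensures that a level `l k` exists.
  set κ : ℝ := min (δ₁ / (C * D₂)) 1 with hκ
  have hκ0 : 0 < κ := by positivity
  have hκ1 : κ ≤ 1 := min_le_right _ _
  have hκδ : C * D₂ * κ ≤ δ₁ := by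
    have := min_le_left (δ₁ / (C * D₂)) 1
    rwa [← hκ, le_div_iff₀ (by positivity), mul_comm] at this
  have hlev : ∀ k : ℕ, ∃ l : ℕ, β ^ (l + 1) < κ * α ^ k ∧ κ * α ^ k ≤ β ^ l := fun k =>
    exists_nat_pow_near_of_lt_one (by positivity)
      (mul_le_one₀ hκ1 (by positivity) (pow_le_one₀ hα0.le hα1.le)) hβ0 hβ1
  choose l hl1 hl2 using hlev
  obtain ⟨c, hc⟩ := exists_pow_lt_of_lt_one (show 0 < δ₂ / (C * D₁ / κ) by positivity) hβ1
  rw [lt_div_iff₀ (by positivity)] at hc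
  refine exists_pow_eq_pow_of_codings (c := c + 1) hm hn p (fun x => q (φ x)) ?_
    (fun k => l k + 1) (κ ^ s) ?_ ?_ ?_ ?_
  · intro w k
    obtain ⟨y, hy⟩ := hq0 w k
    exact ⟨φ.symm y, by simpa using hy⟩
  · refine monotone_nat_of_le_succ fun k => ?_
    have h1 : β ^ (l (k + 1) + 1) < β ^ l k := by
      refine (hl1 (k + 1)).trans_le (le_trans ?_ (hl2 k))
      gcongr κ * ?_
      exact pow_le_pow_of_le_one hα0.le hα1.le k.le_succ
    have := (pow_lt_pow_iff_right_of_lt_one₀ hβ0 hβ1).mp h1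
    omega
  · intro k z x hx
    refine hp2 k x z ?_
    have h1 := hq1 (l k + 1) (φ x) (φ z) hx
    have h2 := (hφ x z).1
    rw [inv_mul_le_iff₀ hC] at h2
    calc dist x z ≤ C * dist (φ x) (φ z) := h2
      _ ≤ C * (D₂ * β ^ (l k + 1)) := by gcongr
      _ < C * (D₂ * (κ * α ^ k)) := by gcongr; exact hl1 k
      _ = C * D₂ * κ * α ^ k := by ring
      _ ≤ δ₁ * α ^ k := by gcongr
  · intro k z x hx
    rw [Nat.add_sub_add_right]
    -- If `l k < c`, truncated subtraction gives depth `0`, where the inclusion is trivial.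
    rcases lt_or_ge (l k) c with hlt | hge
    · intro i hi
      omega
    · refine hq2 (l k - c) (φ x) (φ z) ?_
      calc dist (φ x) (φ z) ≤ C * dist x z := (hφ x z).2
        _ ≤ C * (D₁ * α ^ k) := by gcongr; exact hp1 k x z hx
        _ = C * D₁ / κ * (κ * α ^ k) := by field_simp
        _ ≤ C * D₁ / κ * β ^ l k := by gcongr; exact hl2 k
        _ = β ^ c * (C * D₁ / κ) * β ^ (l k - c) := by
          rw [← Nat.add_sub_cancel' hge, pow_add, Nat.add_sub_cancel_left]; ring
        _ < δ₂ * β ^ (l k - c) := by gcongr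
  · intro k
    have hpow : ∀ {γ : ℝ} {N : ℕ}, 0 < γ → (N : ℝ) * γ ^ s = 1 → ∀ j : ℕ,
        (γ ^ j) ^ s = ((N : ℝ) ^ j)⁻¹ := fun hγ h j => by
      rw [← Real.rpow_natCast, ← Real.rpow_mul hγ.le, mul_comm, Real.rpow_mul hγ.le,
        Real.rpow_natCast, eq_inv_of_mul_eq_one_right h, inv_pow]
    have h1 := Real.rpow_le_rpow (by positivity) (hl1 k).le hs.le
    rw [Real.mul_rpow hκ0.le (by positivity), hpow hβ0 hβs, hpow hα0 hαs] at h1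
    have hm0 : (0 : ℝ) < m := by positivity
    have hn0 : (0 : ℝ) < n := by positivity
    rwa [← div_eq_mul_inv, inv_le_iff_one_le_mul₀ (by positivity), div_mul_eq_mul_div,
      one_le_div (by positivity)] at h1

/-! ### Construction and iteration of homogeneous dust-like sets -/

/-- The self-similar subset of the line with `k` pieces of ratio `c`, translated by
`0, …, k - 1`. -/
lemma exists_linear_cantorSet {k : ℕ} (hk : 1 ≤ k) {c : ℝ} (hc : 0 < c) (hkc : k * c < 1) :
    ∃ K : Set ℝ, K.Nonempty ∧ IsCompact K ∧
      (∀ x, x ∈ K ↔ ∃ i : Fin k, ∃ y ∈ K, c * y + i = x) ∧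
      ∀ x ∈ K, ∀ y ∈ K, ∀ i j : Fin k, c * x + i = c * y + j → i = j := by
  have : NeZero k := ⟨by omega⟩
  have hk1 : (1 : ℝ) ≤ k := by exact_mod_cast hk
  have hc1 : c < 1 := by nlinarith
  have hdigit : ∀ i : Fin k, (i : ℝ) ≤ k - 1 := fun i => by
    have : ((i : ℕ) : ℝ) + 1 ≤ k := by exact_mod_cast i.2
    linarith
  have hgeo : HasSum (fun j : ℕ => c ^ j * ((k : ℝ) - 1)) ((1 - c)⁻¹ * (k - 1)) :=
    (hasSum_geometric_of_lt_one hc.le hc1).mul_right _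
  have hle : ∀ (a : ℕ → Fin k) (j : ℕ), c ^ j * (a j : ℝ) ≤ c ^ j * ((k : ℝ) - 1) := fun a j => by
    gcongr; exact hdigit _
  have hnonneg : ∀ (a : ℕ → Fin k) (j : ℕ), 0 ≤ c ^ j * (a j : ℝ) := fun a j => by positivity
  have hsum : ∀ a : ℕ → Fin k, Summable fun j => c ^ j * (a j : ℝ) := fun a =>
    Summable.of_nonneg_of_le (hnonneg a) (hle a) hgeo.summable
  set π : (ℕ → Fin k) → ℝ := fun a => ∑' j, c ^ j * (a j : ℝ) with hπ
  have hcont : Continuous π := by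
    refine continuous_tsum (u := fun j : ℕ => c ^ j * ((k : ℝ) - 1)) (fun j => ?_) hgeo.summable
      fun j a => ?_
    · exact continuous_const.mul
        ((continuous_of_discreteTopology (f := fun i : Fin k => (i : ℝ))).comp (continuous_apply j))
    · rw [Real.norm_of_nonneg (hnonneg a j)]
      exact hle a j
  have hsplit : ∀ a, π a = c * π (fun j => a (j + 1)) + a 0 := fun a => by
    simp only [hπ]
    rw [(hsum a).tsum_eq_zero_add, ← tsum_mul_left, pow_zero, one_mul, add_comm]
    congr 1
    exact tsum_congr fun j => by ring
  have h0 : ∀ a, 0 ≤ π a := fun a => tsum_nonneg (hnonneg a)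
  have h1 : ∀ a, π a ≤ (1 - c)⁻¹ * (k - 1) := fun a =>
    ((hsum a).tsum_le_tsum (hle a) hgeo.summable).trans_eq hgeo.tsum_eq
  -- This is where `k * c < 1` enters: the piece with digit `i` lies in `[i, i + 1)`.
  have hlt : c * ((1 - c)⁻¹ * (k - 1)) < 1 := by
    rw [mul_left_comm, inv_mul_lt_iff₀ (by linarith)]
    linarith
  refine ⟨Set.range π, Set.range_nonempty _, isCompact_range hcont, fun x => ⟨?_, ?_⟩, ?_⟩
  · rintro ⟨a, rfl⟩
    exact ⟨a 0, _, ⟨fun j => a (j + 1), rfl⟩, (hsplit a).symm⟩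
  · rintro ⟨i, _, ⟨a, rfl⟩, rfl⟩
    exact ⟨fun j => Nat.casesOn j i a, hsplit _⟩
  · rintro _ ⟨a, rfl⟩ _ ⟨b, rfl⟩ i j h
    have ha : c * π a < 1 := (mul_le_mul_of_nonneg_left (h1 a) hc.le).trans_lt hlt
    have hb : c * π b < 1 := (mul_le_mul_of_nonneg_left (h1 b) hc.le).trans_lt hlt
    have ha0 := mul_nonneg hc.le (h0 a)
    have hb0 := mul_nonneg hc.le (h0 b)
    have hij : ((i : ℕ) : ℝ) < (j : ℕ) + 1 := by linarith
    have hji : ((j : ℕ) : ℝ) < (i : ℕ) + 1 := by linarith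
    have hij' : (i : ℕ) < j + 1 := by exact_mod_cast hij
    have hji' : (j : ℕ) < i + 1 := by exact_mod_cast hji
    exact Fin.ext (by omega)

/-- Homogeneous contraction vectors are realized by a product of linear Cantor sets scaled by
`1, γ, …, γ ^ (d - 1)`, the similarities permuting the coordinates cyclically. -/
lemma dustLike_nonempty {d k : ℕ} (hd : 1 ≤ d) (hk : 1 ≤ k) {γ : ℝ} (hγ : 0 < γ)
    (hkγ : k * γ ^ d < 1) : (dustLike d (fun _ : Fin k => γ)).Nonempty := by
  obtain ⟨e, rfl⟩ : ∃ e, d = e + 1 := ⟨d - 1, by omega⟩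
  obtain ⟨K, hne, hcpt, hK, hKd⟩ := exists_linear_cantorSet hk (pow_pos hγ (e + 1)) hkγ
  set P : (Fin (e + 1) → ℝ) → EuclideanSpace ℝ (Fin (e + 1)) :=
    fun y => WithLp.toLp 2 fun l => γ ^ (l : ℕ) * y l with hP
  set R : EuclideanSpace ℝ (Fin (e + 1)) ≃ₗᵢ[ℝ] EuclideanSpace ℝ (Fin (e + 1)) :=
    LinearIsometryEquiv.piLpCongrLeft 2 ℝ ℝ (finRotate (e + 1)) with hR
  set t : Fin k → EuclideanSpace ℝ (Fin (e + 1)) :=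
    fun i => EuclideanSpace.single (Fin.last e) ((i : ℝ) / γ) with ht
  have hcont : Continuous P := by
    simp only [hP]; fun_prop
  have hRapp : ∀ x l, R x (finRotate (e + 1) l) = x l := fun x l => by
    simp [hR, LinearIsometryEquiv.piLpCongrLeft_apply, Equiv.piCongrLeft']
  -- Scaling by `γ` and rotating turns weight `γ ^ l` into the next one; the last coordinate returns
  -- to position `0` with factor `γ ^ (e + 1)`, the ratio of `K`.
  have hf : ∀ i y, similarity γ R (t i) (P y) =
      P (Fin.cons (γ ^ (e + 1) * y (Fin.last e) + i) (fun l : Fin e => y l.castSucc)) := by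
    intro i y
    ext l
    obtain ⟨l, rfl⟩ := (finRotate (e + 1)).surjective l
    simp only [similarity, PiLp.smul_apply, hRapp, PiLp.add_apply, smul_eq_mul]
    refine Fin.lastCases ?_ (fun l => ?_) l
    · rw [finRotate_last]
      simp [hP, ht]
      field_simp
      ring
    · have : finRotate (e + 1) l.castSucc = l.succ := by
        rw [finRotate_apply, Fin.coeSucc_eq_succ]
      rw [this]
      simp [hP, ht, pow_succ]
      ring
  have hinj : ∀ y z, P y = P z → y = z := fun y z h => by
    funext l
    have := congrArg (fun v : EuclideanSpace ℝ (Fin (e + 1)) => v l) h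
    simpa [hP, hγ.ne'] using this
  refine ⟨P '' Set.univ.pi fun _ => K, (Set.univ_pi_nonempty_iff.mpr fun _ => hne).image _,
    (isCompact_univ_pi fun _ => hcpt).image hcont, fun _ => R, t, ?_, ?_⟩
  · ext x
    simp only [Set.mem_iUnion]
    constructor
    · rintro ⟨z, hz, rfl⟩
      obtain ⟨i, w, hw, hwz⟩ := (hK (z 0)).mp (hz 0 trivial)
      refine ⟨i, _, ⟨Fin.snoc (α := fun _ => ℝ) (fun l => z l.succ) w, ?_, rfl⟩, ?_⟩
      · intro l _
        refine Fin.lastCases ?_ (fun l => ?_) l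
        · simpa using hw
        · simpa using hz l.succ trivial
      · refine (hf i _).trans ?_
        congr 1
        funext l
        refine Fin.cases ?_ (fun l => ?_) l
        · simpa using hwz
        · simp
    · rintro ⟨i, _, ⟨y, hy, rfl⟩, rfl⟩
      refine ⟨_, ?_, (hf i y).symm⟩
      intro l _
      refine Fin.cases ?_ (fun l => ?_) l
      · exact (hK _).mpr ⟨i, _, hy (Fin.last e) trivial, rfl⟩
      · exact hy l.castSucc trivial
  · intro i j hij
    rw [Set.disjoint_left]
    rintro _ ⟨_, ⟨y, hy, rfl⟩, rfl⟩ ⟨_, ⟨z, hz, rfl⟩, h⟩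
    rw [hf, hf] at h
    have h0 := congrFun (hinj _ _ h) 0
    simp only [Fin.cons_zero] at h0
    exact hij (hKd _ (hy _ trivial) _ (hz _ trivial) _ _ h0.symm)

lemma similarity_comp {d : ℕ} {r r' : ℝ} (hr' : r' ≠ 0)
    (R R' : EuclideanSpace ℝ (Fin d) ≃ₗᵢ[ℝ] EuclideanSpace ℝ (Fin d))
    (t t' x : EuclideanSpace ℝ (Fin d)) :
    similarity r R t (similarity r' R' t' x) =
      similarity (r * r') (R'.trans R) (t' + r'⁻¹ • R'.symm t) x := by
  simp only [similarity, LinearIsometryEquiv.trans_apply, map_add, map_smul, smul_add,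
    LinearIsometryEquiv.apply_symm_apply, smul_smul]
  rw [mul_assoc, mul_inv_cancel₀ hr', mul_one]
  abel

lemma similarity_injective {d : ℕ} {r : ℝ} (hr : r ≠ 0)
    (R : EuclideanSpace ℝ (Fin d) ≃ₗᵢ[ℝ] EuclideanSpace ℝ (Fin d))
    (t : EuclideanSpace ℝ (Fin d)) : Function.Injective (similarity r R t) := fun _ _ h =>
  add_right_cancel (R.injective (smul_right_injective _ hr h))

lemma mem_dustLike_mul {d a b : ℕ} {r r' : ℝ} (hr : r ≠ 0) (hr' : r' ≠ 0)
    {E : Set (EuclideanSpace ℝ (Fin d))} (h : E ∈ dustLike d (fun _ : Fin a => r))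
    (h' : E ∈ dustLike d (fun _ : Fin b => r')) :
    E ∈ dustLike d (fun _ : Fin (a * b) => r * r') := by
  obtain ⟨hne, hcpt, R, t, hU, hd⟩ := h
  obtain ⟨-, -, R', t', hU', hd'⟩ := h'
  have himg : ∀ i j, similarity (r * r') ((R' j).trans (R i)) (t' j + r'⁻¹ • (R' j).symm (t i)) '' E
      = similarity r (R i) (t i) '' (similarity r' (R' j) (t' j) '' E) := fun i j => by
    rw [Set.image_image]
    exact Set.image_congr fun x _ => (similarity_comp hr' _ _ _ _ _).symm
  refine ⟨hne, hcpt, fun u => (R' (finProdFinEquiv.symm u).2).trans (R (finProdFinEquiv.symm u).1),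
    fun u => t' (finProdFinEquiv.symm u).2 +
      r'⁻¹ • (R' (finProdFinEquiv.symm u).2).symm (t (finProdFinEquiv.symm u).1), ?_, ?_⟩
  · simp only [himg]
    rw [finProdFinEquiv.symm.surjective.iUnion_comp
      fun u : Fin a × Fin b => similarity r (R u.1) (t u.1) '' (similarity r' (R' u.2) (t' u.2) '' E),
      Set.iUnion_prod']
    simp only [← Set.image_iUnion]
    rw [← hU', ← hU]
  · intro u v huv
    simp only [himg]
    have huv' : finProdFinEquiv.symm u ≠ finProdFinEquiv.symm v :=
      fun h => huv (finProdFinEquiv.symm.injective h)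
    have hsub : ∀ j, similarity r' (R' j) (t' j) '' E ⊆ E := fun j =>
      (Set.subset_iUnion (fun j => similarity r' (R' j) (t' j) '' E) j).trans hU'.superset
    by_cases h1 : (finProdFinEquiv.symm u).1 = (finProdFinEquiv.symm v).1
    · rw [h1]
      refine (Set.disjoint_image_iff (similarity_injective hr _ _)).mpr (hd' _ _ fun h2 => ?_)
      exact huv' (Prod.ext h1 h2)
    -- Different outer indices: the pieces lie in disjoint first-level pieces.
    · exact (hd _ _ h1).mono (Set.image_mono (hsub _)) (Set.image_mono (hsub _))

lemma mem_dustLike_pow {d k : ℕ} {γ : ℝ} (hγ : γ ≠ 0) {E : Set (EuclideanSpace ℝ (Fin d))}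
    (h : E ∈ dustLike d (fun _ : Fin k => γ)) (v : ℕ) :
    E ∈ dustLike d (fun _ : Fin (k ^ v) => γ ^ v) := by
  induction v with
  -- The zeroth iterate is the identity alone; `dustLike` does not require ratios below `1`.
  | zero =>
    refine ⟨h.1, h.2.1, fun _ => LinearIsometryEquiv.refl ℝ _, fun _ => 0, ?_, ?_⟩
    · have : similarity (1 : ℝ) (LinearIsometryEquiv.refl ℝ (EuclideanSpace ℝ (Fin d))) 0 = id := by
        funext x; simp [similarity]
      simp only [pow_zero, this, Set.image_id]
      exact (Set.iUnion_const E).symm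
    · intro i j hij
      exact absurd (Subsingleton.elim (α := Fin 1) i j) hij
  | succ v ih => exact mem_dustLike_mul (pow_ne_zero v hγ) hγ ih h

lemma lipschitzEquivalent_refl {d : ℕ} (E : Set (EuclideanSpace ℝ (Fin d))) :
    LipschitzEquivalent E E :=
  ⟨Equiv.refl _, 1, one_pos, fun x y => by simp⟩

lemma dustLikeEquivalent_of_pow_eq_pow {d m n u v : ℕ} (hd : 1 ≤ d) (hm : 1 ≤ m) {α β s : ℝ}
    (hs : s ≠ 0) (hα0 : 0 < α) (hβ0 : 0 < β) (hmα : m * α ^ d < 1)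
    (hαs : (m : ℝ) * α ^ s = 1) (hβs : (n : ℝ) * β ^ s = 1)
    (hv : v ≠ 0) (huv : u.Coprime v) (h : m ^ u = n ^ v) :
    DustLikeEquivalent d (fun _ : Fin m => α) (fun _ : Fin n => β) := by
  obtain ⟨k, rfl, rfl⟩ := Nat.exists_eq_pow_of_exponent_coprime_of_pow_eq_pow huv h
  have hk : 1 ≤ k := Nat.one_le_iff_ne_zero.mpr fun h0 => by
    rw [h0, zero_pow hv] at hm; omega
  have hk0 : (0 : ℝ) < k := by exact_mod_cast hk
  set γ : ℝ := α ^ ((v : ℝ)⁻¹) with hγ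
  have hγ0 : 0 < γ := Real.rpow_pos_of_pos hα0 _
  have hγv : γ ^ v = α := Real.rpow_inv_natCast_pow hα0.le hv
  have hcomm : ∀ w : ℕ, (γ ^ w) ^ s = (γ ^ s) ^ w := fun w => by
    rw [← Real.rpow_natCast, ← Real.rpow_mul hγ0.le, mul_comm, Real.rpow_mul hγ0.le,
      Real.rpow_natCast]
  have hγs : (k : ℝ) * γ ^ s = 1 := by
    rw [← hγv, hcomm, Nat.cast_pow, ← mul_pow] at hαs
    exact (pow_eq_one_iff_of_nonneg (by positivity) hv).mp hαs
  have hγu : γ ^ u = β := by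
    -- Both `γ ^ u` and `β` have `s`-th power `1 / k ^ u`, and `s ≠ 0`.
    refine Real.rpow_left_injOn hs (pow_pos hγ0 u).le hβ0.le ?_
    have h1 : ((k ^ u : ℕ) : ℝ) * (γ ^ u) ^ s = 1 := by
      rw [hcomm, Nat.cast_pow, ← mul_pow, hγs, one_pow]
    have h2 : ((k ^ u : ℕ) : ℝ) ≠ 0 := by positivity
    exact mul_left_cancel₀ h2 (h1.trans hβs.symm)
  have hkγ : k * γ ^ d < 1 := by
    rw [← hγv, Nat.cast_pow, ← pow_mul, mul_comm v d, pow_mul, ← mul_pow] at hmα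
    exact (pow_lt_one_iff_of_nonneg (by positivity) hv).mp hmα
  obtain ⟨E, hE⟩ := dustLike_nonempty hd hk hγ0 hkγ
  refine ⟨E, ?_, E, ?_, lipschitzEquivalent_refl E⟩
  · rw [← hγv]; exact mem_dustLike_pow hγ0.ne' hE v
  · rw [← hγu]; exact mem_dustLike_pow hγ0.ne' hE u

end CantorLip

theorem mainTheorem7 (d m n : ℕ) (hm : 2 ≤ m) (hn : 2 ≤ n) (α β s : ℝ)
    (hα : CantorLip.IsContractionVector d (fun _ : Fin m => α))
    (hβ : CantorLip.IsContractionVector d (fun _ : Fin n => β))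
    (hαs : (m : ℝ) * α ^ s = 1) (hβs : (n : ℝ) * β ^ s = 1) :
    CantorLip.DustLikeEquivalent d (fun _ : Fin m => α) (fun _ : Fin n => β) ↔
      ∃ q : ℚ, Real.log m / Real.log n = (q : ℝ) := by
  obtain ⟨hα0, hα1⟩ := hα.1 ⟨0, by omega⟩
  obtain ⟨hβ0, hβ1⟩ := hβ.1 ⟨0, by omega⟩
  have hm' : (2 : ℝ) ≤ m := by exact_mod_cast hm
  have hn' : (2 : ℝ) ≤ n := by exact_mod_cast hn
  have hlm : 0 < Real.log m := Real.log_pos (by linarith)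
  have hln : 0 < Real.log n := Real.log_pos (by linarith)
  have hmα : (m : ℝ) * α ^ d < 1 := by simpa using hα.2
  constructor
  · intro h
    obtain ⟨r, t, hr, hrt⟩ := CantorLip.exists_pow_eq_pow_of_dustLikeEquivalent hm hn
      hα0 hα1 hβ0 hβ1 hαs hβs h
    have hlog : (r : ℝ) * Real.log m = t * Real.log n := by
      rw [← Real.log_pow, ← Real.log_pow]
      exact_mod_cast congrArg (fun x : ℕ => Real.log x) hrt
    have hr0 : (r : ℝ) ≠ 0 := by exact_mod_cast (by omega : r ≠ 0)
    refine ⟨t / r, ?_⟩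
    push_cast
    rw [div_eq_div_iff hln.ne' hr0]
    linarith
  · rintro ⟨q, hq⟩
    have hq0 : 0 < q := by
      have : (0 : ℝ) < q := hq ▸ div_pos hlm hln
      exact_mod_cast this
    have hqd : (q : ℝ) = (q.num.natAbs : ℝ) / q.den := by
      rw [Nat.cast_natAbs, abs_of_pos (Rat.num_pos.mpr hq0)]
      exact Rat.cast_def q
    have hden : (q.den : ℝ) ≠ 0 := by exact_mod_cast q.den_nz
    rw [hqd, div_eq_div_iff hln.ne' hden] at hq
    have hpow : m ^ q.den = n ^ q.num.natAbs := by
      have h1 : Real.log ((m : ℝ) ^ q.den) = Real.log ((n : ℝ) ^ q.num.natAbs) := by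
        rw [Real.log_pow, Real.log_pow]; linarith
      have h2 := Real.log_injOn_pos (Set.mem_Ioi.mpr (by positivity))
        (Set.mem_Ioi.mpr (by positivity)) h1
      exact_mod_cast h2
    -- For `d = 0` the contraction condition would read `m < 1`.
    have hd : 1 ≤ d := by
      rcases Nat.eq_zero_or_pos d with rfl | hd
      · rw [pow_zero, mul_one] at hmα; linarith
      · exact hd
    have hs : s ≠ 0 := by
      rintro rfl
      rw [Real.rpow_zero, mul_one] at hαs
      linarith
    exact CantorLip.dustLikeEquivalent_of_pow_eq_pow hd (by omega) hs hα0 hβ0 hmα hαs hβs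
      (Int.natAbs_pos.mpr (Rat.num_pos.mpr hq0).ne').ne' q.reduced.symm hpow
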